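/- Let $-\infty<a<b<\infty$, $\mathcal J=(a,b)$, $L_2=L_2(\mathcal J,\mathbb C)$, and let $p,Q:\mathcal J\to\mathbb R$ be real-valued functions such that $p\neq 0$ almost everywhere and $1/p,\;Q/p,\;Q^2/p\in L_1(\mathcal J)$. Define the quasi-derivatives $$D^{[0]}y=y,\qquad D^{[1]}y=py'-Qy,\qquad D^{[2]}y=(D^{[1]}y)'+\frac{Q}{p}D^{[1]}y+\frac{Q^2}{p}y .$$ Let $L_{\max}$ be the operator on $L_2$ given by $L_{\max}y=-D^{[2]}y$ on $$\operatorname{Dom}(L_{\max})=\{y\in L_2 : y,\,D^{[1]}y\in AC([a,b],\mathbb C),\ D^{[2]}y\in L_2\},$$ and let $L_{\min}$ be its restriction to those $y$ with $D^{[k]}y(a)=D^{[k]}y(b)=0$, $k=0,1$. For $y\in\operatorname{Dom}(L_{\max})$ put $$\Gamma_1y=(D^{[1]}y(a),\,-D^{[1]}y(b)),\qquad \Gamma_2y=(y(a),\,y(b)),$$ and for a linear operator $K$ on the Hilbert space $\mathbb C^2$ let $L_K$ be the restriction of $L_{\max}$ to those $y\in\operatorname{Dom}(L_{\max})$ that satisfy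 $$(K-I)\Gamma_1y+i(K+I)\Gamma_2y=0 .$$ A densely defined linear operator $L$ on a Hilbert space is called dissipative if $\operatorname{Im}(Lf,f)\ge 0$ for all $f\in\operatorname{Dom}(L)$ (the scalar product being linear in its first argument), and maximal dissipative if, in addition, it has no dissipative extension on the same space other than itself. Then $L_{\min}$ is a densely defined symmetric operator, and the following holds. 1. For every $K$ with $\|K\|\le 1$, the operator $L_K$ is a maximal dissipative extension of $L_{\min}$. 2. For every maximal dissipative extension $\widetilde L$ of $L_{\min}$ there is a unique operator $K$ on $\mathbb C^2$ with $\|K\|\le 1$ and $\widetilde L=L_K$. 3. Consequently $K\mapsto L_K$ is a bijection from the set of contractions on $\mathbb C^2$ onto the set of maximal dissipative extensions of $L_{\min}$. -/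

import Mathlib

open MeasureTheory Set

namespace SturmLiouville

/-- The Hilbert space `L₂(𝒥, ℂ)` over the finite interval `𝒥 = (a, b)`. -/
abbrev L2 (a b : ℝ) : Type := Lp ℂ 2 (volume.restrict (Ioo a b))

/-- `y` and its quasi-derivative `w = D^[1] y = p y' - Q y` are absolutely continuous on `[a, b]`
(the defining equation of `w` is understood almost everywhere on `(a, b)`). -/
structure IsQuasiPair (p Q : ℝ → ℝ) (a b : ℝ) (y w : ℝ → ℂ) : Prop where
  ac_fst : AbsolutelyContinuousOnInterval y a b
  ac_snd : AbsolutelyContinuousOnInterval w a b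
  eq_ae : ∀ᵐ t ∂volume.restrict (Ioo a b), w t = (p t : ℂ) * deriv y t - (Q t : ℂ) * y t

/-- `D^[2] y = (D^[1] y)' + (Q / p) D^[1] y + (Q² / p) y`, where `w = D^[1] y`. -/
noncomputable def quasiD2 (p Q : ℝ → ℝ) (y w : ℝ → ℂ) (t : ℝ) : ℂ :=
  deriv w t + ((Q t / p t : ℝ) : ℂ) * w t + ((Q t ^ 2 / p t : ℝ) : ℂ) * y t

section aux

variable {p Q : ℝ → ℝ} {a b : ℝ} {y w y₁ w₁ y₂ w₂ : ℝ → ℂ}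

theorem ae_differentiableAt (hy : AbsolutelyContinuousOnInterval y a b) :
    ∀ᵐ t ∂volume.restrict (Ioo a b), DifferentiableAt ℝ y t := by
  have h := hy.boundedVariationOn.ae_differentiableAt_of_mem_uIcc
  rw [ae_restrict_iff' measurableSet_Ioo]
  filter_upwards [h] with t ht hm
  exact ht (Icc_subset_uIcc (Ioo_subset_Icc_self hm))

theorem IsQuasiPair.add (h₁ : IsQuasiPair p Q a b y₁ w₁) (h₂ : IsQuasiPair p Q a b y₂ w₂) :
    IsQuasiPair p Q a b (y₁ + y₂) (w₁ + w₂) := by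
  refine ⟨h₁.ac_fst.add h₂.ac_fst, h₁.ac_snd.add h₂.ac_snd, ?_⟩
  filter_upwards [h₁.eq_ae, h₂.eq_ae, ae_differentiableAt h₁.ac_fst, ae_differentiableAt h₂.ac_fst]
    with t e₁ e₂ d₁ d₂
  rw [deriv_add d₁ d₂, Pi.add_apply, Pi.add_apply, e₁, e₂]
  ring

theorem IsQuasiPair.smul (c : ℂ) (h : IsQuasiPair p Q a b y w) :
    IsQuasiPair p Q a b (c • y) (c • w) := by
  refine ⟨h.ac_fst.const_smul c, h.ac_snd.const_smul c, ?_⟩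
  filter_upwards [h.eq_ae, ae_differentiableAt h.ac_fst] with t e d
  rw [deriv_const_smul c d, Pi.smul_apply, Pi.smul_apply, e]
  simp only [smul_eq_mul]
  ring

theorem IsQuasiPair.zero : IsQuasiPair p Q a b 0 0 := by
  have h0 : AbsolutelyContinuousOnInterval (0 : ℝ → ℂ) a b := by
    simpa [AbsolutelyContinuousOnInterval] using tendsto_const_nhds
  refine ⟨h0, h0, Filter.Eventually.of_forall fun t => ?_⟩
  simp

theorem quasiD2_add (h₁ : IsQuasiPair p Q a b y₁ w₁) (h₂ : IsQuasiPair p Q a b y₂ w₂) :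
    quasiD2 p Q (y₁ + y₂) (w₁ + w₂) =ᵐ[volume.restrict (Ioo a b)]
      quasiD2 p Q y₁ w₁ + quasiD2 p Q y₂ w₂ := by
  filter_upwards [ae_differentiableAt h₁.ac_snd, ae_differentiableAt h₂.ac_snd] with t d₁ d₂
  simp only [quasiD2, Pi.add_apply]
  rw [deriv_add d₁ d₂]
  ring

theorem quasiD2_smul (c : ℂ) (h : IsQuasiPair p Q a b y w) :
    quasiD2 p Q (c • y) (c • w) =ᵐ[volume.restrict (Ioo a b)] c • quasiD2 p Q y w := by
  filter_upwards [ae_differentiableAt h.ac_snd] with t d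
  simp only [quasiD2, Pi.smul_apply]
  rw [deriv_const_smul c d]
  simp only [smul_eq_mul]
  ring

theorem eqOn_of_ae_eq (hab : a < b) {f g : ℝ → ℂ} (hf : AbsolutelyContinuousOnInterval f a b)
    (hg : AbsolutelyContinuousOnInterval g a b) (h : f =ᵐ[volume.restrict (Ioo a b)] g) :
    EqOn f g (Icc a b) := by
  have hf' := hf.continuousOn
  have hg' := hg.continuousOn
  rw [uIcc_of_le hab.le] at hf' hg'
  rw [restrict_Ioo_eq_restrict_Icc] at h
  exact Measure.eqOn_Icc_of_ae_eq volume hab.ne h hf' hg'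

theorem deriv_eq_of_eqOn {f g : ℝ → ℂ} (h : EqOn f g (Icc a b)) {t : ℝ} (ht : t ∈ Ioo a b) :
    deriv f t = deriv g t :=
  Filter.EventuallyEq.deriv_eq
    (Filter.mem_of_superset (isOpen_Ioo.mem_nhds ht) fun _ hs => h (Ioo_subset_Icc_self hs))

theorem IsQuasiPair.eqOn_fst (hab : a < b) (h₁ : IsQuasiPair p Q a b y₁ w₁)
    (h₂ : IsQuasiPair p Q a b y₂ w₂) (h : y₁ =ᵐ[volume.restrict (Ioo a b)] y₂) :
    EqOn y₁ y₂ (Icc a b) :=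
  eqOn_of_ae_eq hab h₁.ac_fst h₂.ac_fst h

theorem IsQuasiPair.eqOn_snd (hab : a < b) (h₁ : IsQuasiPair p Q a b y₁ w₁)
    (h₂ : IsQuasiPair p Q a b y₂ w₂) (h : y₁ =ᵐ[volume.restrict (Ioo a b)] y₂) :
    EqOn w₁ w₂ (Icc a b) := by
  refine eqOn_of_ae_eq hab h₁.ac_snd h₂.ac_snd ?_
  filter_upwards [h₁.eq_ae, h₂.eq_ae, ae_restrict_mem measurableSet_Ioo] with t e₁ e₂ ht
  rw [e₁, e₂, deriv_eq_of_eqOn (h₁.eqOn_fst hab h₂ h) ht,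
    h₁.eqOn_fst hab h₂ h (Ioo_subset_Icc_self ht)]

theorem IsQuasiPair.quasiD2_ae_eq (hab : a < b) (h₁ : IsQuasiPair p Q a b y₁ w₁)
    (h₂ : IsQuasiPair p Q a b y₂ w₂) (h : y₁ =ᵐ[volume.restrict (Ioo a b)] y₂) :
    quasiD2 p Q y₁ w₁ =ᵐ[volume.restrict (Ioo a b)] quasiD2 p Q y₂ w₂ := by
  filter_upwards [ae_restrict_mem measurableSet_Ioo] with t ht
  have ht' := Ioo_subset_Icc_self ht
  simp only [quasiD2]
  rw [deriv_eq_of_eqOn (h₁.eqOn_snd hab h₂ h) ht, h₁.eqOn_fst hab h₂ h ht',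
    h₁.eqOn_snd hab h₂ h ht']

end aux

/-- `y` and `w` are the absolutely continuous representatives of `f ∈ L₂` and of its
quasi-derivative `D^[1] f`, and `D^[2] f` is in `L₂`. -/
structure IsRep (p Q : ℝ → ℝ) (a b : ℝ) (f : L2 a b) (y w : ℝ → ℂ) : Prop where
  pair : IsQuasiPair p Q a b y w
  ae_eq : f =ᵐ[volume.restrict (Ioo a b)] y
  memLp : MemLp (quasiD2 p Q y w) 2 (volume.restrict (Ioo a b))

section aux

variable {p Q : ℝ → ℝ} {a b : ℝ} {f g : L2 a b} {y w y₁ w₁ y₂ w₂ : ℝ → ℂ}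

theorem IsRep.add (h₁ : IsRep p Q a b f y₁ w₁) (h₂ : IsRep p Q a b g y₂ w₂) :
    IsRep p Q a b (f + g) (y₁ + y₂) (w₁ + w₂) :=
  ⟨h₁.pair.add h₂.pair, (Lp.coeFn_add f g).trans (h₁.ae_eq.add h₂.ae_eq),
    (memLp_congr_ae (quasiD2_add h₁.pair h₂.pair)).2 (h₁.memLp.add h₂.memLp)⟩

theorem IsRep.smul (c : ℂ) (h : IsRep p Q a b f y w) :
    IsRep p Q a b (c • f) (c • y) (c • w) :=
  ⟨h.pair.smul c, (Lp.coeFn_smul c f).trans (h.ae_eq.const_smul c),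
    (memLp_congr_ae (quasiD2_smul c h.pair)).2 (h.memLp.const_smul c)⟩

theorem IsRep.zero : IsRep p Q a b (0 : L2 a b) 0 0 := by
  refine ⟨IsQuasiPair.zero, Lp.coeFn_zero _ _ _, ?_⟩
  have h : quasiD2 p Q 0 0 = 0 := by
    funext t
    simp [quasiD2]
  rw [h]
  exact MemLp.zero

theorem IsRep.eqOn_fst (hab : a < b) (h₁ : IsRep p Q a b f y₁ w₁) (h₂ : IsRep p Q a b f y₂ w₂) :
    EqOn y₁ y₂ (Icc a b) :=
  h₁.pair.eqOn_fst hab h₂.pair (h₁.ae_eq.symm.trans h₂.ae_eq)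

theorem IsRep.eqOn_snd (hab : a < b) (h₁ : IsRep p Q a b f y₁ w₁) (h₂ : IsRep p Q a b f y₂ w₂) :
    EqOn w₁ w₂ (Icc a b) :=
  h₁.pair.eqOn_snd hab h₂.pair (h₁.ae_eq.symm.trans h₂.ae_eq)

theorem IsRep.toLp_eq (hab : a < b) (h₁ : IsRep p Q a b f y₁ w₁) (h₂ : IsRep p Q a b f y₂ w₂) :
    h₁.memLp.toLp _ = h₂.memLp.toLp _ :=
  (MemLp.toLp_eq_toLp_iff _ _).2
    (h₁.pair.quasiD2_ae_eq hab h₂.pair (h₁.ae_eq.symm.trans h₂.ae_eq))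

end aux

/-- `Dom(L_max)`: all `y ∈ L₂` with `y, D^[1] y ∈ AC[a, b]` and `D^[2] y ∈ L₂`. -/
def maxDomain (p Q : ℝ → ℝ) (a b : ℝ) : Submodule ℂ (L2 a b) where
  carrier := {f | ∃ y w, IsRep p Q a b f y w}
  add_mem' := by
    rintro f g ⟨y₁, w₁, h₁⟩ ⟨y₂, w₂, h₂⟩
    exact ⟨_, _, h₁.add h₂⟩
  zero_mem' := ⟨_, _, IsRep.zero⟩
  smul_mem' := by
    rintro c f ⟨y, w, h⟩
    exact ⟨_, _, h.smul c⟩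

section operators

variable {p Q : ℝ → ℝ} {a b : ℝ}

/-- An absolutely continuous representative of `f ∈ Dom(L_max)`. -/
noncomputable def rep (f : maxDomain p Q a b) : ℝ → ℂ := f.2.choose

/-- The absolutely continuous version of `D^[1] f` for `f ∈ Dom(L_max)`. -/
noncomputable def repD1 (f : maxDomain p Q a b) : ℝ → ℂ := f.2.choose_spec.choose

theorem isRep (f : maxDomain p Q a b) : IsRep p Q a b f (rep f) (repD1 f) :=
  f.2.choose_spec.choose_spec

/-- The maximal operator `L_max y = l[y] = -D^[2] y` on `L₂`. -/
noncomputable def Lmax (p Q : ℝ → ℝ) {a b : ℝ} (hab : a < b) : L2 a b →ₗ.[ℂ] L2 a b where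
  domain := maxDomain p Q a b
  toFun :=
    { toFun := fun f => -(isRep f).memLp.toLp (quasiD2 p Q (rep f) (repD1 f))
      map_add' := by
        intro f g
        rw [(isRep (f + g)).toLp_eq hab ((isRep f).add (isRep g)), ← neg_add,
          ← MemLp.toLp_add, neg_inj]
        exact (MemLp.toLp_eq_toLp_iff _ _).2 (quasiD2_add (isRep f).pair (isRep g).pair)
      map_smul' := by
        intro c f
        rw [(isRep (c • f)).toLp_eq hab ((isRep f).smul c), RingHom.id_apply, smul_neg,
          ← MemLp.toLp_const_smul, neg_inj]
        exact (MemLp.toLp_eq_toLp_iff _ _).2 (quasiD2_smul c (isRep f).pair) }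

/-- The value `y(c) = (D^[0] y)(c)`, `c ∈ [a, b]`, as a linear functional of `y ∈ Dom(L_max)`. -/
noncomputable def evalD0 (p Q : ℝ → ℝ) {a b : ℝ} (hab : a < b) {c : ℝ} (hc : c ∈ Icc a b) :
    maxDomain p Q a b →ₗ[ℂ] ℂ where
  toFun f := rep f c
  map_add' f g := (isRep (f + g)).eqOn_fst hab ((isRep f).add (isRep g)) hc
  map_smul' k f := (isRep (k • f)).eqOn_fst hab ((isRep f).smul k) hc

/-- The value `(D^[1] y)(c)`, `c ∈ [a, b]`, as a linear functional of `y ∈ Dom(L_max)`. -/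
noncomputable def evalD1 (p Q : ℝ → ℝ) {a b : ℝ} (hab : a < b) {c : ℝ} (hc : c ∈ Icc a b) :
    maxDomain p Q a b →ₗ[ℂ] ℂ where
  toFun f := repD1 f c
  map_add' f g := (isRep (f + g)).eqOn_snd hab ((isRep f).add (isRep g)) hc
  map_smul' k f := (isRep (k • f)).eqOn_snd hab ((isRep f).smul k) hc

/-- The restriction of `L_max` to a subspace `S` of its domain. -/
noncomputable def restrictMax (p Q : ℝ → ℝ) {a b : ℝ} (hab : a < b)
    (S : Submodule ℂ (maxDomain p Q a b)) : L2 a b →ₗ.[ℂ] L2 a b :=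
  (Lmax p Q hab).domRestrict (S.map (maxDomain p Q a b).subtype)

/-- The minimal operator: the restriction of `L_max` to those `y` with
`(D^[k] y)(a) = (D^[k] y)(b) = 0`, `k = 0, 1`. -/
noncomputable def Lmin (p Q : ℝ → ℝ) {a b : ℝ} (hab : a < b) : L2 a b →ₗ.[ℂ] L2 a b :=
  restrictMax p Q hab
    (LinearMap.ker (evalD0 p Q hab (left_mem_Icc.2 hab.le)) ⊓
      LinearMap.ker (evalD0 p Q hab (right_mem_Icc.2 hab.le)) ⊓
      LinearMap.ker (evalD1 p Q hab (left_mem_Icc.2 hab.le)) ⊓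
      LinearMap.ker (evalD1 p Q hab (right_mem_Icc.2 hab.le)))

/-- `Γ₁ y = (D^[1] y(a), -D^[1] y(b))`. -/
noncomputable def Gamma1 (p Q : ℝ → ℝ) {a b : ℝ} (hab : a < b) :
    maxDomain p Q a b →ₗ[ℂ] EuclideanSpace ℂ (Fin 2) :=
  (WithLp.linearEquiv 2 ℂ (Fin 2 → ℂ)).symm.toLinearMap ∘ₗ
    LinearMap.pi ![evalD1 p Q hab (left_mem_Icc.2 hab.le),
      -evalD1 p Q hab (right_mem_Icc.2 hab.le)]

/-- `Γ₂ y = (y(a), y(b))`. -/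
noncomputable def Gamma2 (p Q : ℝ → ℝ) {a b : ℝ} (hab : a < b) :
    maxDomain p Q a b →ₗ[ℂ] EuclideanSpace ℂ (Fin 2) :=
  (WithLp.linearEquiv 2 ℂ (Fin 2 → ℂ)).symm.toLinearMap ∘ₗ
    LinearMap.pi ![evalD0 p Q hab (left_mem_Icc.2 hab.le),
      evalD0 p Q hab (right_mem_Icc.2 hab.le)]

/-- `L_K`: the restriction of `L_max` to those `y` with
`(K - I) Γ₁ y + i (K + I) Γ₂ y = 0`. -/
noncomputable def LK (p Q : ℝ → ℝ) {a b : ℝ} (hab : a < b)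
    (K : EuclideanSpace ℂ (Fin 2) →L[ℂ] EuclideanSpace ℂ (Fin 2)) : L2 a b →ₗ.[ℂ] L2 a b :=
  restrictMax p Q hab
    (LinearMap.ker ((K - 1).toLinearMap ∘ₗ Gamma1 p Q hab +
      Complex.I • ((K + 1).toLinearMap ∘ₗ Gamma2 p Q hab)))

end operators

section dissipative

variable {H : Type*} [NormedAddCommGroup H] [InnerProductSpace ℂ H]

/-- Symmetric: densely defined and `(A f, g) = (f, A g)` on the domain. -/
def IsSymmetricOp (A : H →ₗ.[ℂ] H) : Prop :=
  Dense (A.domain : Set H) ∧ ∀ f g : A.domain, inner ℂ (A f) (g : H) = inner ℂ (f : H) (A g)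

/-- Dissipative: densely defined and `Im (A f, f) ≥ 0` on the domain. The scalar product `(u, v)`
that is linear in its first argument is `inner ℂ v u`. -/
def IsDissipative (A : H →ₗ.[ℂ] H) : Prop :=
  Dense (A.domain : Set H) ∧ ∀ f : A.domain, 0 ≤ (inner ℂ (f : H) (A f)).im

/-- Maximal dissipative: dissipative without nontrivial dissipative extensions. -/
def IsMaximalDissipative (A : H →ₗ.[ℂ] H) : Prop :=
  IsDissipative A ∧ ∀ B : H →ₗ.[ℂ] H, IsDissipative B → A ≤ B → B = A

end dissipative

end SturmLiouville

/-! Everything reduces to linear algebra of boundary values. With `Γ± = Γ₁ ± iΓ₂`, the condition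
defining `L_K` reads `K Γ₊ y = Γ₋ y`. Green's formula (`green`) gives `4 Im (L_max y, y) = ‖Γ₊ y‖² -
‖Γ₋ y‖²` (`im_inner_lmax`), so a restriction of `L_max` that extends `L_min` is dissipative exactly
when `‖Γ₋ y‖ ≤ ‖Γ₊ y‖` on its domain, that is, when the pairs `(Γ₊ y, Γ₋ y)` form the graph of a
contraction defined on a subspace of `ℂ²`. Such a contraction extends to all of `ℂ²`
(`exists_contraction`), and one defined everywhere has no proper extension; hence maximal
dissipative extensions correspond to contractions `K`.

Two analytic facts make this work. The boundary maps are jointly onto (`exists_Gamma_eq`), which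
gives maximality of `L_K` and uniqueness of `K`. The adjoint of `L_min` lies in `L_max`
(`exists_lmax_eq_of_adjoint`), which gives density of `Dom(L_min)` and, with the symmetry of
`L_min`, shows that every dissipative extension is a restriction of `L_max`
(`exists_eq_restrictMax`). Both rest on solving the Cauchy problem for `-D^[2] y = h` with
coefficients that are only integrable (`exists_isQuasiPair`). -/

namespace SturmLiouville

/-! ### Calculus of absolutely continuous vector-valued functions. -/

section absolutelyContinuous

variable {X Y E : Type*} [PseudoMetricSpace X] [PseudoMetricSpace Y]
  [NormedAddCommGroup E] [NormedSpace ℝ E] {a b : ℝ}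

theorem absolutelyContinuousOnInterval_of_dist_le {f : ℝ → X} {g : ℝ → Y}
    (hg : AbsolutelyContinuousOnInterval g a b)
    (h : ∀ s ∈ uIcc a b, ∀ t ∈ uIcc a b, dist (f s) (f t) ≤ dist (g s) (g t)) :
    AbsolutelyContinuousOnInterval f a b := by
  rw [absolutelyContinuousOnInterval_iff] at hg ⊢
  intro ε hε
  obtain ⟨δ, hδ, H⟩ := hg ε hε
  refine ⟨δ, hδ, fun I hI hlt => lt_of_le_of_lt (Finset.sum_le_sum fun i hi => ?_) (H I hI hlt)⟩
  exact h _ (hI.1 i hi).1 _ (hI.1 i hi).2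

theorem absolutelyContinuousOnInterval_integral [CompleteSpace E] {f : ℝ → E}
    (hf : IntervalIntegrable f volume a b) :
    AbsolutelyContinuousOnInterval (fun x => ∫ t in a..x, f t) a b := by
  refine absolutelyContinuousOnInterval_of_dist_le
    (hf.norm.absolutelyContinuousOnInterval_intervalIntegral (c := a) left_mem_uIcc) ?_
  intro s hs t ht
  have hs' : IntervalIntegrable f volume a s :=
    hf.mono_set (uIcc_subset_uIcc left_mem_uIcc hs)
  have ht' : IntervalIntegrable f volume a t :=
    hf.mono_set (uIcc_subset_uIcc left_mem_uIcc ht)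
  rw [dist_eq_norm, dist_eq_norm, intervalIntegral.integral_interval_sub_left hs' ht',
    intervalIntegral.integral_interval_sub_left hs'.norm ht'.norm, Real.norm_eq_abs]
  exact intervalIntegral.norm_integral_le_abs_integral_norm

/-- The difference of `f` and the primitive of `g` is absolutely continuous with derivative zero
almost everywhere, hence constant. -/
theorem integral_eq_sub_of_ae_hasDerivAt [CompleteSpace E] (hab : a ≤ b) {f g : ℝ → E}
    (hf : AbsolutelyContinuousOnInterval f a b)
    (hfg : ∀ᵐ t ∂volume.restrict (Ioo a b), HasDerivAt f (g t) t)
    (hg : IntervalIntegrable g volume a b) :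
    ∫ t in a..b, g t = f b - f a := by
  have h0 : AbsolutelyContinuousOnInterval (fun x => f x - ∫ t in a..x, g t) a b :=
    hf.sub (absolutelyContinuousOnInterval_integral hg)
  obtain ⟨C, hC⟩ := h0.const_of_ae_hasDerivAt_zero (by
    rw [restrict_Ioo_eq_restrict_Icc, ae_restrict_iff' measurableSet_Icc] at hfg
    filter_upwards [hfg, hg.ae_hasDerivAt_integral] with x h₁ h₂ hx
    have h := (h₁ (by rwa [uIcc_of_le hab] at hx)).sub (h₂ hx a left_mem_uIcc)
    rwa [sub_self] at h)
  have ha := hC a left_mem_uIcc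
  have hb := hC b right_mem_uIcc
  rw [intervalIntegral.integral_same, sub_zero] at ha
  rw [ha, ← hb, sub_sub_cancel]

end absolutelyContinuous

/-! ### Carathéodory-type existence for a first-order system. -/

section integralEquation

variable {E : Type*} [NormedAddCommGroup E] [NormedSpace ℝ E] [CompleteSpace E] {a b : ℝ}

/-- The integrand is almost everywhere half the derivative of the exponential. That exponential is
monotone, so the integral of its derivative is at most its increment. This estimate supplies the
ratio `1 / 2` of the contraction below. -/
theorem integral_mul_exp_le {k : ℝ → ℝ} (hk : Integrable k) (hk0 : ∀ t, 0 ≤ k t) {t : ℝ}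
    (hat : a ≤ t) :
    ∫ s in a..t, k s * Real.exp (2 * ∫ r in a..s, k r) ≤
      Real.exp (2 * ∫ r in a..t, k r) / 2 := by
  have hmono : Monotone fun s => Real.exp (2 * ∫ r in a..s, k r) := by
    intro s u hsu
    have h : (0 : ℝ) ≤ (∫ r in a..u, k r) - ∫ r in a..s, k r := by
      rw [intervalIntegral.integral_interval_sub_left hk.intervalIntegrable hk.intervalIntegrable]
      exact intervalIntegral.integral_nonneg hsu fun r _ => hk0 r
    exact Real.exp_le_exp.2 (by linarith)
  have h1 := (hmono.monotoneOn (uIcc a t)).intervalIntegral_deriv_mem_uIcc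
  rw [uIcc_of_le (sub_nonneg.2 (hmono hat))] at h1
  have h2 : ∫ s in a..t, deriv (fun s => Real.exp (2 * ∫ r in a..s, k r)) s =
      2 * ∫ s in a..t, k s * Real.exp (2 * ∫ r in a..s, k r) := by
    rw [← intervalIntegral.integral_const_mul]
    refine intervalIntegral.integral_congr_ae ?_
    filter_upwards [LocallyIntegrable.ae_hasDerivAt_integral hk.locallyIntegrable] with s hs _
    rw [((hs a).const_mul 2).exp.deriv]
    ring
  have h3 := h1.2
  simp only [h2, intervalIntegral.integral_same, mul_zero, Real.exp_zero] at h3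
  linarith

/-- Solvability of `Y' = G(t, Y)`, `Y(a) = c` under an integrable Lipschitz condition. -/
theorem exists_integral_equation (hab : a ≤ b) {G : ℝ → E → E} {k : ℝ → ℝ} (hk : Integrable k)
    (hk0 : ∀ t, 0 ≤ k t)
    (hG : ∀ Z : ℝ → E, Continuous Z → Integrable fun t => G t (Z t))
    (hL : ∀ t x y, ‖G t x - G t y‖ ≤ k t * ‖x - y‖) (c : E) :
    ∃ Y : ℝ → E, Continuous Y ∧ ∀ t ∈ Icc a b, Y t = c + ∫ s in a..t, G s (Y s) := by
  set m : ℝ → ℝ := fun t => ∫ s in a..t, k s with hm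
  have hmc : Continuous m := intervalIntegral.continuous_primitive
    (fun _ _ => hk.intervalIntegrable) a
  -- The fixed-point unknown is `Z = exp(-2m) Y`; this weight makes the Picard map contract on the
  -- whole interval at once, however large the integral of `k`.
  set ext : C(Icc a b, E) → ℝ → E := fun Z t => Real.exp (2 * m t) • IccExtend hab Z t with hext
  have hextc : ∀ Z, Continuous (ext Z) := fun Z =>
    (Real.continuous_exp.comp (continuous_const.mul hmc)).smul Z.continuous.Icc_extend'
  have hGi : ∀ Z, Integrable fun t => G t (ext Z t) := fun Z => hG _ (hextc Z)
  let T : C(Icc a b, E) → C(Icc a b, E) := fun Z =>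
    ⟨fun t => Real.exp (-(2 * m t)) • (c + ∫ s in a..(t : ℝ), G s (ext Z s)), by
      have h1 : Continuous fun t : ℝ => ∫ s in a..t, G s (ext Z s) :=
        intervalIntegral.continuous_primitive (fun _ _ => (hGi Z).intervalIntegrable) a
      have h2 : Continuous fun t : ℝ =>
          Real.exp (-(2 * m t)) • (c + ∫ s in a..t, G s (ext Z s)) :=
        (Real.continuous_exp.comp (continuous_const.mul hmc).neg).smul (continuous_const.add h1)
      exact h2.comp continuous_subtype_val⟩
  have hT : ContractingWith (1 / 2) T := by
    refine ⟨by rw [← NNReal.coe_lt_coe]; norm_num, LipschitzWith.of_dist_le_mul fun Z W => ?_⟩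
    rw [ContinuousMap.dist_le (by positivity)]
    intro t
    have hat : a ≤ (t : ℝ) := t.2.1
    have hbound : ∀ s, ‖G s (ext Z s) - G s (ext W s)‖ ≤
        dist Z W * (k s * Real.exp (2 * m s)) := by
      intro s
      refine (hL s _ _).trans ?_
      have h1 : ‖ext Z s - ext W s‖ ≤ Real.exp (2 * m s) * dist Z W := by
        rw [hext]
        simp only
        rw [← smul_sub, norm_smul, Real.norm_eq_abs, Real.abs_exp, ← dist_eq_norm]
        exact mul_le_mul_of_nonneg_left (ContinuousMap.dist_apply_le_dist _) (Real.exp_pos _).le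
      calc k s * ‖ext Z s - ext W s‖ ≤ k s * (Real.exp (2 * m s) * dist Z W) :=
            mul_le_mul_of_nonneg_left h1 (hk0 s)
        _ = _ := by ring
    have hint : IntervalIntegrable (fun s => dist Z W * (k s * Real.exp (2 * m s))) volume a t :=
      ((hk.intervalIntegrable).mul_continuousOn
        (Real.continuous_exp.comp (continuous_const.mul hmc)).continuousOn).const_mul _
    have h2 : ‖∫ s in a..(t : ℝ), (G s (ext Z s) - G s (ext W s))‖ ≤
        dist Z W * (Real.exp (2 * m t) / 2) := by
      refine (intervalIntegral.norm_integral_le_of_norm_le hat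
        (Filter.Eventually.of_forall fun s _ => hbound s) hint).trans ?_
      rw [intervalIntegral.integral_const_mul]
      exact mul_le_mul_of_nonneg_left (integral_mul_exp_le hk hk0 hat) dist_nonneg
    have h3 : T Z t - T W t = Real.exp (-(2 * m t)) •
        ∫ s in a..(t : ℝ), (G s (ext Z s) - G s (ext W s)) := by
      rw [intervalIntegral.integral_sub (hGi Z).intervalIntegrable (hGi W).intervalIntegrable]
      simp only [T, ContinuousMap.coe_mk]
      rw [← smul_sub, add_sub_add_left_eq_sub]
    rw [dist_eq_norm, h3, norm_smul, Real.norm_eq_abs, Real.abs_exp]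
    calc _ ≤ Real.exp (-(2 * m t)) * (dist Z W * (Real.exp (2 * m t) / 2)) :=
          mul_le_mul_of_nonneg_left h2 (Real.exp_pos _).le
      _ = (Real.exp (-(2 * m t)) * Real.exp (2 * m t)) * (dist Z W / 2) := by ring
      _ = _ := by
        rw [← Real.exp_add, neg_add_cancel, Real.exp_zero]
        push_cast
        ring
  have hfix : T (hT.fixedPoint T) = hT.fixedPoint T := hT.fixedPoint_isFixedPt
  refine ⟨ext (hT.fixedPoint T), hextc _, fun t ht => ?_⟩
  have h := congrArg (fun Z : C(Icc a b, E) => Z ⟨t, ht⟩) hfix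
  simp only [T, ContinuousMap.coe_mk] at h
  conv_lhs => rw [hext]
  simp only
  rw [IccExtend_of_mem hab _ ht, ← h, smul_smul, ← Real.exp_add, add_neg_cancel, Real.exp_zero,
    one_smul]

end integralEquation

end SturmLiouville

namespace SturmLiouville

/-! ### Conjugation and the Lagrange identity. -/

section lagrange

variable {p Q : ℝ → ℝ} {a b : ℝ} {y w z v : ℝ → ℂ}

/-- Holds because `p` and `Q` are real. It lets the bilinear Lagrange identity yield the
sesquilinear Green formula, while the identity without conjugation yields the Wronskian. -/
theorem IsQuasiPair.conj (h : IsQuasiPair p Q a b y w) :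
    IsQuasiPair p Q a b (star y) (star w) := by
  have hd : ∀ f : ℝ → ℂ, ∀ s t : ℝ, dist (star f s) (star f t) ≤ dist (f s) (f t) :=
    fun f s t => (Complex.isometry_conj.dist_eq (f s) (f t)).le
  refine ⟨absolutelyContinuousOnInterval_of_dist_le h.ac_fst fun s _ t _ => hd _ s t,
    absolutelyContinuousOnInterval_of_dist_le h.ac_snd fun s _ t _ => hd _ s t, ?_⟩
  filter_upwards [h.eq_ae, ae_differentiableAt h.ac_fst] with t e d
  have h1 : deriv (star y) t = star (deriv y t) := d.hasDerivAt.star.deriv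
  rw [h1, Pi.star_apply, Pi.star_apply, e]
  simp

theorem IsQuasiPair.quasiD2_conj (h : IsQuasiPair p Q a b y w) :
    quasiD2 p Q (star y) (star w) =ᵐ[volume.restrict (Ioo a b)] star (quasiD2 p Q y w) := by
  filter_upwards [ae_differentiableAt h.ac_snd] with t d
  have h1 : deriv (star w) t = star (deriv w t) := d.hasDerivAt.star.deriv
  simp [quasiD2, h1]

theorem intervalIntegrable_of_memLp (hab : a ≤ b) {f : ℝ → ℂ}
    (hf : MemLp f 2 (volume.restrict (Ioo a b))) : IntervalIntegrable f volume a b := by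
  rw [intervalIntegrable_iff_integrableOn_Ioo_of_le hab]
  exact hf.integrable (by norm_num)

/-- The Lagrange identity for the quasi-differential expression. -/
theorem IsQuasiPair.lagrange (hab : a ≤ b) (hp : ∀ᵐ t ∂volume.restrict (Ioo a b), p t ≠ 0)
    (h₁ : IsQuasiPair p Q a b y w) (h₂ : IsQuasiPair p Q a b z v)
    (m₁ : MemLp (quasiD2 p Q y w) 2 (volume.restrict (Ioo a b)))
    (m₂ : MemLp (quasiD2 p Q z v) 2 (volume.restrict (Ioo a b))) :
    ∫ t in a..b, (quasiD2 p Q y w t * z t - y t * quasiD2 p Q z v t) =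
      (w b * z b - y b * v b) - (w a * z a - y a * v a) := by
  refine integral_eq_sub_of_ae_hasDerivAt (f := fun t => w t * z t - y t * v t) hab ?_ ?_ ?_
  · exact (h₁.ac_snd.smul h₂.ac_fst).sub (h₁.ac_fst.smul h₂.ac_snd)
  · filter_upwards [hp, h₁.eq_ae, h₂.eq_ae, ae_differentiableAt h₁.ac_fst,
      ae_differentiableAt h₁.ac_snd, ae_differentiableAt h₂.ac_fst,
      ae_differentiableAt h₂.ac_snd] with t hpt e₁ e₂ d₁ d₂ d₃ d₄
    have hp' : (p t : ℂ) ≠ 0 := by exact_mod_cast hpt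
    have h := (d₂.hasDerivAt.mul d₃.hasDerivAt).sub (d₁.hasDerivAt.mul d₄.hasDerivAt)
    refine HasDerivAt.congr_deriv h ?_
    -- Once `y'` and `z'` are written through the quasi-derivatives, the terms `w v / p` and all
    -- terms containing `Q` cancel.
    have ey : deriv y t = (w t + Q t * y t) / p t := by rw [e₁]; field_simp; ring
    have ez : deriv z t = (v t + Q t * z t) / p t := by rw [e₂]; field_simp; ring
    rw [ey, ez, quasiD2, quasiD2]
    push_cast
    field_simp
    ring
  · exact ((intervalIntegrable_of_memLp hab m₁).mul_continuousOn h₂.ac_fst.continuousOn).sub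
      ((intervalIntegrable_of_memLp hab m₂).continuousOn_mul h₁.ac_fst.continuousOn)

end lagrange

/-! ### The Cauchy problem for the quasi-differential equation. -/

section solutions

variable {p Q : ℝ → ℝ} {a b : ℝ}

theorem exists_isQuasiPair (hab : a < b) (hp : ∀ᵐ t ∂volume.restrict (Ioo a b), p t ≠ 0)
    (hp1 : IntegrableOn (fun t => 1 / p t) (Ioo a b))
    (hQp : IntegrableOn (fun t => Q t / p t) (Ioo a b))
    (hQ2p : IntegrableOn (fun t => Q t ^ 2 / p t) (Ioo a b))
    {h : ℝ → ℂ} (hh : IntegrableOn h (Ioo a b)) (c d : ℂ) :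
    ∃ y w : ℝ → ℂ, IsQuasiPair p Q a b y w ∧
      quasiD2 p Q y w =ᵐ[volume.restrict (Ioo a b)] h ∧ y a = c ∧ w a = d := by
  set α : ℝ → ℂ := fun t => ((1 / p t : ℝ) : ℂ) with hα
  set β : ℝ → ℂ := fun t => ((Q t / p t : ℝ) : ℂ) with hβ
  set γ : ℝ → ℂ := fun t => ((Q t ^ 2 / p t : ℝ) : ℂ) with hγ
  have hαi : IntegrableOn α (Ioo a b) := hp1.ofReal
  have hβi : IntegrableOn β (Ioo a b) := hQp.ofReal
  have hγi : IntegrableOn γ (Ioo a b) := hQ2p.ofReal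
  -- The equation `D^[2] y = h` as a system for `(y, D^[1] y)`; its coefficients are exactly the
  -- functions assumed integrable.
  set F : ℝ → ℂ × ℂ → ℂ × ℂ := fun t x =>
    (β t * x.1 + α t * x.2, h t - β t * x.2 - γ t * x.1) with hF
  have hFi : ∀ Z : ℝ → ℂ × ℂ, Continuous Z → IntegrableOn (fun t => F t (Z t)) (Ioo a b) := by
    intro Z hZ
    have key : ∀ f : ℝ → ℂ, IntegrableOn f (Ioo a b) → ∀ g : ℝ → ℂ, Continuous g →
        IntegrableOn (fun t => f t * g t) (Ioo a b) := fun f hf g hg => by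
      rw [← integrableOn_Icc_iff_integrableOn_Ioo] at hf ⊢
      exact hf.mul_continuousOn hg.continuousOn isCompact_Icc
    exact ((key β hβi _ hZ.fst).add (key α hαi _ hZ.snd)).prodMk
      ((hh.sub (key β hβi _ hZ.snd)).sub (key γ hγi _ hZ.fst))
  -- For the sup norm on `ℂ × ℂ` the two components have Lipschitz constants `‖α‖ + ‖β‖` and `‖β‖ +
  -- ‖γ‖`; their sum dominates both.
  set k : ℝ → ℝ := (Ioo a b).indicator fun t => ‖α t‖ + ‖β t‖ + ‖β t‖ + ‖γ t‖ with hk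
  have hki : Integrable k := (integrable_indicator_iff measurableSet_Ioo).2
    (((hαi.norm.add hβi.norm).add hβi.norm).add hγi.norm)
  obtain ⟨Y, hYc, hY⟩ := exists_integral_equation hab.le
    (G := fun t x => (Ioo a b).indicator (fun t => F t x) t) hki
    (fun t => indicator_nonneg (fun _ _ => by positivity) t)
    (fun Z hZ => by
      have h1 := (integrable_indicator_iff measurableSet_Ioo).2 (hFi Z hZ)
      refine h1.congr (Filter.Eventually.of_forall fun t => ?_)
      by_cases ht : t ∈ Ioo a b <;> simp [ht])
    (fun t x x' => by
      by_cases ht : t ∈ Ioo a b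
      · simp only [hk, indicator_of_mem ht]
        have e : F t x - F t x' = (β t * (x - x').1 + α t * (x - x').2,
            - β t * (x - x').2 - γ t * (x - x').1) := by
          simp only [hF, Prod.mk_sub_mk, Prod.fst_sub, Prod.snd_sub]
          ext <;> simp <;> ring
        have b1 := norm_fst_le (x - x')
        have b2 := norm_snd_le (x - x')
        have B : ∀ (f g u u' : ℂ), ‖u‖ ≤ ‖x - x'‖ → ‖u'‖ ≤ ‖x - x'‖ →
            ‖f * u‖ + ‖g * u'‖ ≤ (‖f‖ + ‖g‖) * ‖x - x'‖ := fun f g u u' hu hu' => by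
          rw [norm_mul, norm_mul, add_mul]
          gcongr
        rw [e, Prod.norm_mk, max_le_iff]
        constructor
        · refine (norm_add_le _ _).trans ((B _ _ _ _ b1 b2).trans ?_)
          exact mul_le_mul_of_nonneg_right
            (by linarith [norm_nonneg (β t), norm_nonneg (γ t)]) (norm_nonneg _)
        · refine (norm_sub_le _ _).trans ((B _ _ _ _ b2 b1).trans ?_)
          exact mul_le_mul_of_nonneg_right
            (by rw [norm_neg]; linarith [norm_nonneg (β t), norm_nonneg (α t)]) (norm_nonneg _)
      · simp [hk, ht]) (c, d)
  set g : ℝ → ℂ × ℂ := fun t => F t (Y t) with hg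
  have hgi : IntervalIntegrable g volume a b := by
    rw [intervalIntegrable_iff_integrableOn_Ioo_of_le hab.le]
    exact hFi Y hYc
  have hYg : ∀ t ∈ Icc a b, Y t = (c, d) + ∫ s in a..t, g s := by
    intro t ht
    rw [hY t ht]
    congr 1
    refine intervalIntegral.integral_congr_ae ?_
    -- On `(a, t]` the indicator of `(a, b)` can differ from `1` only at `s = b`, when `t = b`.
    have hne : ∀ᵐ s ∂(volume : Measure ℝ), s ≠ b := Measure.ae_ne volume b
    filter_upwards [hne] with s hs hst
    rw [uIoc_of_le ht.1] at hst
    have hm : s ∈ Ioo a b := ⟨hst.1, lt_of_le_of_ne (hst.2.trans ht.2) hs⟩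
    exact indicator_of_mem hm _
  have hYac : AbsolutelyContinuousOnInterval Y a b := by
    refine absolutelyContinuousOnInterval_of_dist_le
      (absolutelyContinuousOnInterval_integral hgi) fun s hs t ht => ?_
    rw [uIcc_of_le hab.le] at hs ht
    rw [hYg s hs, hYg t ht, dist_add_left]
  have hYd : ∀ᵐ t ∂volume.restrict (Ioo a b), HasDerivAt Y (g t) t := by
    rw [ae_restrict_iff' measurableSet_Ioo]
    filter_upwards [hgi.ae_hasDerivAt_integral] with t ht hm
    have h1 := (ht (by rw [uIcc_of_le hab.le]; exact Ioo_subset_Icc_self hm) a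
      left_mem_uIcc).const_add (c, d)
    exact h1.congr_of_eventuallyEq
      (Filter.mem_of_superset (isOpen_Ioo.mem_nhds hm) fun s hs => hYg s (Ioo_subset_Icc_self hs))
  have hYa : Y a = (c, d) := by rw [hYg a (left_mem_Icc.2 hab.le)]; simp
  refine ⟨fun t => (Y t).1, fun t => (Y t).2, ⟨?_, ?_, ?_⟩, ?_, by simp [hYa], by simp [hYa]⟩
  · exact absolutelyContinuousOnInterval_of_dist_le hYac fun s _ t _ => le_max_left _ _
  · exact absolutelyContinuousOnInterval_of_dist_le hYac fun s _ t _ => le_max_right _ _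
  · filter_upwards [hYd, hp] with t ht hpt
    have hp' : (p t : ℂ) ≠ 0 := by exact_mod_cast hpt
    have h1 : HasDerivAt (fun t => (Y t).1) (g t).1 t := by
      simpa using ht.hasFDerivAt.fst.hasDerivAt
    rw [h1.deriv]
    simp only [hg, hF, hα, hβ]
    push_cast
    field_simp
    ring
  · filter_upwards [hYd] with t ht
    have h1 : HasDerivAt (fun t => (Y t).2) (g t).2 t := by
      simpa using ht.hasFDerivAt.snd.hasDerivAt
    rw [quasiD2, h1.deriv]
    simp only [hg, hF, hβ, hγ]
    ring

end solutions

end SturmLiouville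

namespace SturmLiouville

/-- The coefficients are regular on `(a, b)`. -/
structure IsRegular (p Q : ℝ → ℝ) (a b : ℝ) : Prop where
  ne_zero : ∀ᵐ t ∂volume.restrict (Ioo a b), p t ≠ 0
  inv : IntegrableOn (fun t => 1 / p t) (Ioo a b)
  div : IntegrableOn (fun t => Q t / p t) (Ioo a b)
  sq_div : IntegrableOn (fun t => Q t ^ 2 / p t) (Ioo a b)

/-! ### Green's formula, surjectivity of the boundary maps, and the adjoint of the minimal operator.
-/

section boundary

variable {p Q : ℝ → ℝ} {a b : ℝ}

/-- `L_max` as a linear map on its domain. -/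
noncomputable def lmax (p Q : ℝ → ℝ) {a b : ℝ} (hab : a < b) :
    maxDomain p Q a b →ₗ[ℂ] L2 a b := (Lmax p Q hab).toFun

theorem lmax_apply (hab : a < b) (f : maxDomain p Q a b) :
    lmax p Q hab f = -(isRep f).memLp.toLp (quasiD2 p Q (rep f) (repD1 f)) := rfl

theorem coeFn_lmax (hab : a < b) (f : maxDomain p Q a b) :
    lmax p Q hab f =ᵐ[volume.restrict (Ioo a b)] -quasiD2 p Q (rep f) (repD1 f) := by
  rw [lmax_apply]
  exact (Lp.coeFn_neg _).trans (isRep f).memLp.coeFn_toLp.neg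

theorem exists_lmax_eq (hr : IsRegular p Q a b) (hab : a < b) (h : L2 a b) (c d : ℂ) :
    ∃ f : maxDomain p Q a b, lmax p Q hab f = h ∧ rep f a = c ∧ repD1 f a = d := by
  have hh : IntegrableOn (-h : ℝ → ℂ) (Ioo a b) :=
    ((Lp.memLp h).integrable (by norm_num)).neg
  obtain ⟨y, w, hyw, hD, hya, hwa⟩ :=
    exists_isQuasiPair hab hr.ne_zero hr.inv hr.div hr.sq_div hh c d
  have hyc : ContinuousOn y (Icc a b) := by simpa [uIcc_of_le hab.le] using hyw.ac_fst.continuousOn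
  have hym : MemLp y 2 (volume.restrict (Ioo a b)) := by
    obtain ⟨C, hC⟩ := hyw.ac_fst.exists_bound
    refine MemLp.of_bound
      ((hyc.mono Ioo_subset_Icc_self).aestronglyMeasurable measurableSet_Ioo) C ?_
    filter_upwards [ae_restrict_mem measurableSet_Ioo] with t ht
    exact hC t (by rw [uIcc_of_le hab.le]; exact Ioo_subset_Icc_self ht)
  have hrep : IsRep p Q a b (hym.toLp y) y w :=
    ⟨hyw, hym.coeFn_toLp, (memLp_congr_ae hD).2 (Lp.memLp h).neg⟩
  let f : maxDomain p Q a b := ⟨hym.toLp y, y, w, hrep⟩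
  have ha := left_mem_Icc.2 hab.le
  refine ⟨f, ?_, ((isRep f).eqOn_fst hab hrep ha).trans hya,
    ((isRep f).eqOn_snd hab hrep ha).trans hwa⟩
  rw [lmax_apply, (isRep f).toLp_eq hab hrep, neg_eq_iff_eq_neg]
  apply Lp.ext
  exact (hrep.memLp.coeFn_toLp.trans hD).trans (Lp.coeFn_neg h).symm

/-- Green's formula. -/
theorem green (hr : IsRegular p Q a b) (hab : a < b) (f g : maxDomain p Q a b) :
    inner ℂ (g : L2 a b) (lmax p Q hab f) - inner ℂ (lmax p Q hab g) (f : L2 a b) =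
      inner ℂ (Gamma2 p Q hab g) (Gamma1 p Q hab f) -
        inner ℂ (Gamma1 p Q hab g) (Gamma2 p Q hab f) := by
  have hf := isRep f
  have hg := isRep g
  have hl := hf.pair.lagrange hab.le hr.ne_zero hg.pair.conj hf.memLp
    ((memLp_congr_ae hg.pair.quasiD2_conj).2 hg.memLp.star)
  have e : inner ℂ (g : L2 a b) (lmax p Q hab f) - inner ℂ (lmax p Q hab g) (f : L2 a b) =
      -∫ t in a..b, (quasiD2 p Q (rep f) (repD1 f) t * star (rep g) t -
        rep f t * quasiD2 p Q (star (rep g)) (star (repD1 g)) t) := by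
    rw [L2.inner_def, L2.inner_def, ← integral_sub (L2.integrable_inner _ _)
      (L2.integrable_inner _ _), intervalIntegral.integral_of_le hab.le,
      integral_Ioc_eq_integral_Ioo, ← integral_neg]
    refine integral_congr_ae ?_
    filter_upwards [hf.ae_eq, hg.ae_eq, coeFn_lmax hab f, coeFn_lmax hab g,
      hg.pair.quasiD2_conj] with t e₁ e₂ e₃ e₄ e₅
    rw [e₁, e₂, e₃, e₄, e₅]
    simp
    ring
  rw [e, hl]
  simp [Gamma1, Gamma2, evalD0, evalD1, PiLp.inner_apply, Fin.sum_univ_two]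
  ring

/-- The Wronskian of two solutions of the homogeneous equation is constant. -/
theorem wronskian_eq (hr : IsRegular p Q a b) (hab : a < b) {f g : maxDomain p Q a b}
    (hf : lmax p Q hab f = 0) (hg : lmax p Q hab g = 0) :
    repD1 f b * rep g b - rep f b * repD1 g b = repD1 f a * rep g a - rep f a * repD1 g a := by
  have h0 : ∀ u : maxDomain p Q a b, lmax p Q hab u = 0 →
      quasiD2 p Q (rep u) (repD1 u) =ᵐ[volume.restrict (Ioo a b)] 0 := by
    intro u hu
    have h := coeFn_lmax hab u
    rw [hu] at h
    filter_upwards [h, Lp.coeFn_zero ℂ 2 (volume.restrict (Ioo a b))] with t h₁ h₂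
    rw [h₂] at h₁
    simpa using h₁.symm
  have hl := (isRep f).pair.lagrange hab.le hr.ne_zero (isRep g).pair (isRep f).memLp
    (isRep g).memLp
  rw [intervalIntegral.integral_of_le hab.le, integral_Ioc_eq_integral_Ioo,
    integral_eq_zero_of_ae] at hl
  · exact (sub_eq_zero.1 hl.symm)
  · filter_upwards [h0 f hf, h0 g hg] with t h₁ h₂
    simp [h₁, h₂]

theorem exists_fundamental (hr : IsRegular p Q a b) (hab : a < b) :
    ∃ v₁ v₂ : maxDomain p Q a b, lmax p Q hab v₁ = 0 ∧ lmax p Q hab v₂ = 0 ∧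
      (∀ c₁ c₂ : ℂ, rep (c₁ • v₁ + c₂ • v₂) a = c₁ ∧ repD1 (c₁ • v₁ + c₂ • v₂) a = c₂) ∧
      repD1 v₁ b * rep v₂ b - rep v₁ b * repD1 v₂ b = -1 := by
  obtain ⟨v₁, h₁, h₁₀, h₁₁⟩ := exists_lmax_eq hr hab 0 1 0
  obtain ⟨v₂, h₂, h₂₀, h₂₁⟩ := exists_lmax_eq hr hab 0 0 1
  refine ⟨v₁, v₂, h₁, h₂, fun c₁ c₂ => ⟨?_, ?_⟩, ?_⟩
  · have h := map_add (evalD0 p Q hab (left_mem_Icc.2 hab.le)) (c₁ • v₁) (c₂ • v₂)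
    rw [map_smul, map_smul] at h
    refine h.trans ?_
    simp [evalD0, h₁₀, h₂₀]
  · have h := map_add (evalD1 p Q hab (left_mem_Icc.2 hab.le)) (c₁ • v₁) (c₂ • v₂)
    rw [map_smul, map_smul] at h
    refine h.trans ?_
    simp [evalD1, h₁₁, h₂₁]
  · rw [wronskian_eq hr hab h₁ h₂, h₁₀, h₁₁, h₂₀, h₂₁]
    ring

/-- Green's formula for `f` with zero data at `a` and a solution `v` of the homogeneous equation. -/
theorem inner_lmax_of_left_eq_zero (hr : IsRegular p Q a b) (hab : a < b)
    {f v : maxDomain p Q a b} (hv : lmax p Q hab v = 0) (h₀ : rep f a = 0) (h₁ : repD1 f a = 0) :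
    inner ℂ (v : L2 a b) (lmax p Q hab f) =
      star (repD1 v b) * rep f b - star (rep v b) * repD1 f b := by
  have h := green hr hab f v
  rw [hv, inner_zero_left, sub_zero] at h
  rw [h]
  simp [Gamma1, Gamma2, evalD0, evalD1, PiLp.inner_apply, Fin.sum_univ_two, h₀, h₁]
  ring

theorem Gamma1_eq_iff (hab : a < b) (f : maxDomain p Q a b) (x : EuclideanSpace ℂ (Fin 2)) :
    Gamma1 p Q hab f = x ↔ repD1 f a = x 0 ∧ -repD1 f b = x 1 := by
  refine ⟨fun h => by subst h; simp [Gamma1, evalD1], fun h => ?_⟩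
  ext i
  fin_cases i <;> simp [Gamma1, evalD1, ← h.1, ← h.2]

theorem Gamma2_eq_iff (hab : a < b) (f : maxDomain p Q a b) (x : EuclideanSpace ℂ (Fin 2)) :
    Gamma2 p Q hab f = x ↔ rep f a = x 0 ∧ rep f b = x 1 := by
  refine ⟨fun h => by subst h; simp [Gamma2, evalD0], fun h => ?_⟩
  ext i
  fin_cases i <;> simp [Gamma2, evalD0, ← h.1, ← h.2]

/-- Cramer's rule for the conjugated system, whose determinant is the Wronskian `-1`: pairing with
both homogeneous solutions determines the data at `b`. -/
theorem eq_of_det_eq {y₁ y₂ w₁ w₂ y w c d : ℂ} (hdet : w₁ * y₂ - y₁ * w₂ = -1)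
    (h₁ : star w₁ * y - star y₁ * w = star w₁ * c - star y₁ * d)
    (h₂ : star w₂ * y - star y₂ * w = star w₂ * c - star y₂ * d) : y = c ∧ w = d := by
  have hd : star w₁ * star y₂ - star y₁ * star w₂ = -1 := by
    have := congrArg star hdet
    simpa [mul_comm] using this
  constructor
  · linear_combination (y - c) * hd - star y₂ * h₁ + star y₁ * h₂
  · linear_combination (w - d) * hd - star w₂ * h₁ + star w₁ * h₂

/-- The boundary maps are jointly surjective. -/
theorem exists_Gamma_eq (hr : IsRegular p Q a b) (hab : a < b) (x y : EuclideanSpace ℂ (Fin 2)) :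
    ∃ f : maxDomain p Q a b, Gamma1 p Q hab f = x ∧ Gamma2 p Q hab f = y := by
  obtain ⟨v₁, v₂, hv₁, hv₂, hva, hdet⟩ := exists_fundamental hr hab
  let S : ℂ × ℂ →ₗ[ℂ] maxDomain p Q a b :=
    (LinearMap.toSpanSingleton ℂ _ v₁).coprod (LinearMap.toSpanSingleton ℂ _ v₂)
  have hS : ∀ c, S c = c.1 • v₁ + c.2 • v₂ := fun c => by simp [S]
  -- `Ψ` is the Gram matrix of `v₁, v₂`. It is injective: a combination orthogonal to both is
  -- orthogonal to itself, and its data at `a` are its coefficients.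
  let Ψ : ℂ × ℂ →ₗ[ℂ] ℂ × ℂ :=
    ((innerₛₗ ℂ (v₁ : L2 a b)).prod (innerₛₗ ℂ (v₂ : L2 a b))) ∘ₗ
      (maxDomain p Q a b).subtype ∘ₗ S
  have hΨ : ∀ c, Ψ c = (inner ℂ (v₁ : L2 a b) (S c : L2 a b),
      inner ℂ (v₂ : L2 a b) (S c : L2 a b)) := fun c => rfl
  have hinj : Function.Injective Ψ := by
    rw [← LinearMap.ker_eq_bot, LinearMap.ker_eq_bot']
    intro c hc
    rw [hΨ, Prod.mk_eq_zero] at hc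
    have h0 : inner ℂ (S c : L2 a b) (S c : L2 a b) = 0 := by
      conv_lhs => enter [2]; rw [hS]
      rw [Submodule.coe_add, Submodule.coe_smul, Submodule.coe_smul, inner_add_left,
        inner_smul_left, inner_smul_left, hc.1, hc.2, mul_zero, mul_zero, add_zero]
    have h1 : S c = 0 := Subtype.ext (inner_self_eq_zero.1 h0)
    obtain ⟨e₁, e₂⟩ := hva c.1 c.2
    rw [← hS, h1] at e₁ e₂
    have z₁ := map_zero (evalD0 p Q hab (left_mem_Icc.2 hab.le))
    have z₂ := map_zero (evalD1 p Q hab (left_mem_Icc.2 hab.le))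
    exact Prod.ext (e₁.symm.trans z₁) (e₂.symm.trans z₂)
  have hsurj : Function.Surjective Ψ := LinearMap.injective_iff_surjective.1 hinj
  -- `s` has the prescribed data at `a`; `α` and `β` are what is missing at `b`. The correction `f`
  -- has zero data at `a`, and its right-hand side is sought in the span of `v₁, v₂`.
  set s := (y 0) • v₁ + (x 0) • v₂ with hs
  obtain ⟨hs₀, hs₁⟩ := hva (y 0) (x 0)
  set α := y 1 - rep s b with hα
  set β := -x 1 - repD1 s b with hβ
  obtain ⟨c, hc⟩ := hsurj (star (repD1 v₁ b) * α - star (rep v₁ b) * β,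
    star (repD1 v₂ b) * α - star (rep v₂ b) * β)
  rw [hΨ, Prod.mk.injEq] at hc
  obtain ⟨f, hf, hf₀, hf₁⟩ := exists_lmax_eq hr hab (S c : L2 a b) 0 0
  rw [← hf, inner_lmax_of_left_eq_zero hr hab hv₁ hf₀ hf₁,
    inner_lmax_of_left_eq_zero hr hab hv₂ hf₀ hf₁] at hc
  obtain ⟨hfb, hfb'⟩ := eq_of_det_eq hdet hc.1 hc.2
  have add₀ : ∀ t (ht : t ∈ Icc a b), rep (s + f) t = rep s t + rep f t :=
    fun t ht => map_add (evalD0 p Q hab ht) s f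
  have add₁ : ∀ t (ht : t ∈ Icc a b), repD1 (s + f) t = repD1 s t + repD1 f t :=
    fun t ht => map_add (evalD1 p Q hab ht) s f
  have ha := left_mem_Icc.2 hab.le
  have hb := right_mem_Icc.2 hab.le
  refine ⟨s + f, (Gamma1_eq_iff hab _ _).2 ⟨?_, ?_⟩, (Gamma2_eq_iff hab _ _).2 ⟨?_, ?_⟩⟩
  · rw [add₁ a ha, hs₁, hf₁, add_zero]
  · rw [add₁ b hb, hfb', hβ]; ring
  · rw [add₀ a ha, hs₀, hf₀, add_zero]
  · rw [add₀ b hb, hfb, hα]; ring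

/-- The adjoint of the minimal operator is contained in the maximal operator. -/
theorem exists_lmax_eq_of_adjoint (hr : IsRegular p Q a b) (hab : a < b) (g h : L2 a b)
    (H : ∀ f : maxDomain p Q a b, Gamma1 p Q hab f = 0 → Gamma2 p Q hab f = 0 →
      inner ℂ g (lmax p Q hab f) = inner ℂ h (f : L2 a b)) :
    ∃ g' : maxDomain p Q a b, (g' : L2 a b) = g ∧ lmax p Q hab g' = h := by
  obtain ⟨v₁, v₂, hv₁, hv₂, -, hdet⟩ := exists_fundamental hr hab
  obtain ⟨z, hz, -⟩ := exists_lmax_eq hr hab h 0 0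
  let N : Submodule ℂ (L2 a b) := Submodule.span ℂ {(v₁ : L2 a b), (v₂ : L2 a b)}
  have : FiniteDimensional ℂ N := FiniteDimensional.span_of_finite ℂ (Set.toFinite _)
  -- A function `q` orthogonal to the homogeneous solutions is `L_max f` with all boundary data of
  -- `f` zero, so `g` and `z` pair equally with it. As `N` is finite-dimensional, `Nᗮᗮ = N`.
  have hmem : g - z ∈ Nᗮᗮ := by
    rw [Submodule.mem_orthogonal']
    intro q hq
    obtain ⟨f, hf, hf₀, hf₁⟩ := exists_lmax_eq hr hab q 0 0
    rw [Submodule.mem_orthogonal] at hq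
    have q₁ := hq v₁ (Submodule.subset_span (by simp))
    have q₂ := hq v₂ (Submodule.subset_span (by simp))
    rw [← hf, inner_lmax_of_left_eq_zero hr hab hv₁ hf₀ hf₁] at q₁
    rw [← hf, inner_lmax_of_left_eq_zero hr hab hv₂ hf₀ hf₁] at q₂
    obtain ⟨hfb, hfb'⟩ := eq_of_det_eq (c := 0) (d := 0) hdet (by simpa using q₁)
      (by simpa using q₂)
    have g₁ : Gamma1 p Q hab f = 0 := (Gamma1_eq_iff hab f 0).2 (by simp [hf₁, hfb'])
    have g₂ : Gamma2 p Q hab f = 0 := (Gamma2_eq_iff hab f 0).2 (by simp [hf₀, hfb])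
    have hgr := green hr hab f z
    rw [g₁, g₂, inner_zero_right, inner_zero_right, sub_zero, sub_eq_zero, hz] at hgr
    rw [← hf, inner_sub_left, H f g₁ g₂, hgr, sub_self]
  rw [Submodule.orthogonal_orthogonal, Submodule.mem_span_pair] at hmem
  obtain ⟨c₁, c₂, hc⟩ := hmem
  refine ⟨z + (c₁ • v₁ + c₂ • v₂), ?_, ?_⟩
  · simp [hc]
  · simp [hz, hv₁, hv₂]

/-- Functions with zero boundary data are dense. -/
theorem eq_zero_of_inner_eq_zero (hr : IsRegular p Q a b) (hab : a < b) (h : L2 a b)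
    (H : ∀ f : maxDomain p Q a b, Gamma1 p Q hab f = 0 → Gamma2 p Q hab f = 0 →
      inner ℂ h (f : L2 a b) = 0) : h = 0 := by
  -- Orthogonality to `Dom(L_min)` puts `(0, h)` in the adjoint relation of `L_min`, hence in the
  -- graph of `L_max`.
  obtain ⟨g, hg, hg'⟩ := exists_lmax_eq_of_adjoint hr hab 0 h fun f h₁ h₂ => by
    rw [H f h₁ h₂, inner_zero_left]
  have : g = 0 := Subtype.ext hg
  rw [← hg', this, map_zero]

end boundary

end SturmLiouville

namespace SturmLiouville

/-! ### Contractions and elementary identities in inner product spaces. -/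

section abstract

/-- A relation dominated in norm is the graph of a contraction. -/
theorem exists_contraction {V E F : Type*} [AddCommGroup V] [Module ℂ V]
    [NormedAddCommGroup E] [InnerProductSpace ℂ E] [FiniteDimensional ℂ E]
    [NormedAddCommGroup F] [NormedSpace ℂ F] (A : V →ₗ[ℂ] E) (B : V →ₗ[ℂ] F)
    (h : ∀ v, ‖B v‖ ≤ ‖A v‖) : ∃ K : E →L[ℂ] F, ‖K‖ ≤ 1 ∧ ∀ v, K (A v) = B v := by
  obtain ⟨g, hg⟩ := A.rangeRestrict.exists_rightInverse_of_surjective A.range_rangeRestrict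
  have hg' : ∀ x : LinearMap.range A, A (g x) = x := fun x =>
    congrArg Subtype.val (LinearMap.congr_fun hg x)
  -- The projection extends the map by zero off the range of `A` without increasing the norm.
  let K₀ : E →ₗ[ℂ] F :=
    B ∘ₗ g ∘ₗ ((LinearMap.range A).orthogonalProjectionOnto : E →ₗ[ℂ] LinearMap.range A)
  have hK₀ : ∀ x, ‖K₀ x‖ ≤ 1 * ‖x‖ := fun x => by
    refine (h _).trans ?_
    rw [LinearMap.comp_apply, hg', one_mul]
    exact (LinearMap.range A).norm_orthogonalProjectionOnto_apply_le x
  refine ⟨K₀.mkContinuous 1 hK₀, K₀.mkContinuous_norm_le zero_le_one hK₀, fun v => ?_⟩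
  have h1 : (LinearMap.range A).orthogonalProjectionOnto (A v) = ⟨A v, v, rfl⟩ :=
    (LinearMap.range A).orthogonalProjectionOnto_mem_subspace_eq_self ⟨A v, v, rfl⟩
  have h2 : K₀ (A v) = B (g ⟨A v, v, rfl⟩) := by
    simp only [K₀, LinearMap.comp_apply, ContinuousLinearMap.coe_coe, h1]
  -- The chosen preimage does not matter: `A` vanishes on the difference of two preimages, so by
  -- domination `B` does too.
  rw [LinearMap.mkContinuous_apply, h2, ← sub_eq_zero, ← map_sub, ← norm_le_zero_iff]
  refine (h _).trans ?_
  rw [map_sub, hg', sub_self, norm_zero]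

theorem norm_add_I_smul_sq_sub {E : Type*} [NormedAddCommGroup E] [InnerProductSpace ℂ E]
    (x y : E) :
    ‖x + Complex.I • y‖ ^ 2 - ‖x - Complex.I • y‖ ^ 2 = 4 * (inner ℂ y x).im := by
  have h : (inner ℂ x y).im = -(inner ℂ y x).im := by
    rw [← inner_conj_symm x y, Complex.conj_im]
  rw [norm_add_sq (𝕜 := ℂ), norm_sub_sq (𝕜 := ℂ), inner_smul_right]
  simp [h]
  ring

theorem eq_zero_of_forall_nonneg_add_mul {A B : ℝ} (h : ∀ t : ℝ, 0 ≤ A + t * B) : B = 0 := by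
  by_contra hB
  have h1 := h (-(A + 1) / B)
  rw [div_mul_cancel₀ _ hB] at h1
  linarith

end abstract

/-! ### Restrictions of the maximal operator and the classification of dissipative extensions. -/

section restrict

variable {p Q : ℝ → ℝ} {a b : ℝ}

theorem mem_restrictMax_domain (hab : a < b) {S : Submodule ℂ (maxDomain p Q a b)} {f : L2 a b} :
    f ∈ (restrictMax p Q hab S).domain ↔ ∃ g ∈ S, (g : L2 a b) = f := by
  have : (restrictMax p Q hab S).domain =
      S.map (maxDomain p Q a b).subtype ⊓ maxDomain p Q a b := rfl
  rw [this, Submodule.mem_inf, Submodule.mem_map]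
  exact ⟨fun h => h.1, fun h => ⟨h, by obtain ⟨g, -, rfl⟩ := h; exact g.2⟩⟩

theorem restrictMax_apply (hab : a < b) {S : Submodule ℂ (maxDomain p Q a b)}
    (f : (restrictMax p Q hab S).domain) (g : maxDomain p Q a b) (hfg : (f : L2 a b) = g) :
    restrictMax p Q hab S f = lmax p Q hab g :=
  LinearPMap.domRestrict_apply (f := Lmax p Q hab) (y := g) hfg

theorem restrictMax_le_iff (hab : a < b) {S : Submodule ℂ (maxDomain p Q a b)}
    {B : L2 a b →ₗ.[ℂ] L2 a b} :
    restrictMax p Q hab S ≤ B ↔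
      ∀ f ∈ S, ∃ h : (f : L2 a b) ∈ B.domain, B ⟨f, h⟩ = lmax p Q hab f := by
  constructor
  · intro h f hf
    have hm := (mem_restrictMax_domain hab).2 ⟨f, hf, rfl⟩
    refine ⟨h.1 hm, ?_⟩
    rw [← restrictMax_apply hab ⟨f, hm⟩ f rfl]
    exact (h.2 rfl).symm
  · intro h
    refine ⟨fun f hf => ?_, fun f g hfg => ?_⟩
    · obtain ⟨g, hg, rfl⟩ := (mem_restrictMax_domain hab).1 hf
      exact (h g hg).1
    · obtain ⟨u, hu, huf⟩ := (mem_restrictMax_domain hab).1 f.2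
      rw [restrictMax_apply hab f u huf.symm]
      obtain ⟨h₁, h₂⟩ := h u hu
      rw [← h₂]
      congr 1
      exact Subtype.ext (huf.trans hfg)

theorem restrictMax_le_restrictMax_iff (hab : a < b) {S T : Submodule ℂ (maxDomain p Q a b)} :
    restrictMax p Q hab S ≤ restrictMax p Q hab T ↔ S ≤ T := by
  rw [restrictMax_le_iff]
  refine ⟨fun h f hf => ?_, fun h f hf => ?_⟩
  · obtain ⟨g, hg, hgf⟩ := (mem_restrictMax_domain hab).1 (h f hf).1
    rwa [← Subtype.ext hgf]
  · exact ⟨(mem_restrictMax_domain hab).2 ⟨f, h hf, rfl⟩, restrictMax_apply hab _ f rfl⟩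

theorem restrictMax_injective (hab : a < b) : Function.Injective (restrictMax p Q hab) :=
  fun _ _ h => le_antisymm ((restrictMax_le_restrictMax_iff hab).1 h.le)
    ((restrictMax_le_restrictMax_iff hab).1 h.ge)

/-- The domain of the minimal operator, inside the domain of the maximal one. -/
noncomputable def minSubmodule (p Q : ℝ → ℝ) {a b : ℝ} (hab : a < b) :
    Submodule ℂ (maxDomain p Q a b) :=
  LinearMap.ker (Gamma1 p Q hab) ⊓ LinearMap.ker (Gamma2 p Q hab)

theorem mem_minSubmodule (hab : a < b) {f : maxDomain p Q a b} :
    f ∈ minSubmodule p Q hab ↔ Gamma1 p Q hab f = 0 ∧ Gamma2 p Q hab f = 0 := Iff.rfl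

theorem Lmin_eq (hab : a < b) : Lmin p Q hab = restrictMax p Q hab (minSubmodule p Q hab) := by
  rw [Lmin]
  congr 1
  ext f
  rw [mem_minSubmodule, Gamma1_eq_iff, Gamma2_eq_iff]
  simp [evalD0, evalD1]
  tauto

/-- `Γ₁ + i Γ₂`. -/
noncomputable def gammaPlus (p Q : ℝ → ℝ) {a b : ℝ} (hab : a < b) :
    maxDomain p Q a b →ₗ[ℂ] EuclideanSpace ℂ (Fin 2) :=
  Gamma1 p Q hab + Complex.I • Gamma2 p Q hab

/-- `Γ₁ - i Γ₂`. -/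
noncomputable def gammaMinus (p Q : ℝ → ℝ) {a b : ℝ} (hab : a < b) :
    maxDomain p Q a b →ₗ[ℂ] EuclideanSpace ℂ (Fin 2) :=
  Gamma1 p Q hab - Complex.I • Gamma2 p Q hab

theorem exists_gammaPlus_eq (hr : IsRegular p Q a b) (hab : a < b)
    (u v : EuclideanSpace ℂ (Fin 2)) :
    ∃ f : maxDomain p Q a b, gammaPlus p Q hab f = u ∧ gammaMinus p Q hab f = v := by
  -- Solution of `Γ₁ + iΓ₂ = u`, `Γ₁ - iΓ₂ = v`.
  obtain ⟨f, h₁, h₂⟩ := exists_Gamma_eq hr hab ((1 / 2 : ℂ) • (u + v))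
    ((-Complex.I / 2) • (u - v))
  refine ⟨f, ?_, ?_⟩
  · ext i
    simp [gammaPlus, h₁, h₂]
    linear_combination (-(u i - v i) / 2) * Complex.I_sq
  · ext i
    simp [gammaMinus, h₁, h₂]
    linear_combination ((u i - v i) / 2) * Complex.I_sq

/-- The subspace of the maximal domain that defines `L_K`. -/
noncomputable def graphSubmodule (p Q : ℝ → ℝ) {a b : ℝ} (hab : a < b)
    (K : EuclideanSpace ℂ (Fin 2) →L[ℂ] EuclideanSpace ℂ (Fin 2)) :
    Submodule ℂ (maxDomain p Q a b) :=
  LinearMap.ker (K.toLinearMap ∘ₗ gammaPlus p Q hab - gammaMinus p Q hab)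

theorem mem_graphSubmodule (hab : a < b)
    {K : EuclideanSpace ℂ (Fin 2) →L[ℂ] EuclideanSpace ℂ (Fin 2)} {f : maxDomain p Q a b} :
    f ∈ graphSubmodule p Q hab K ↔ K (gammaPlus p Q hab f) = gammaMinus p Q hab f := by
  simp [graphSubmodule, sub_eq_zero]

theorem LK_eq (hab : a < b) (K : EuclideanSpace ℂ (Fin 2) →L[ℂ] EuclideanSpace ℂ (Fin 2)) :
    LK p Q hab K = restrictMax p Q hab (graphSubmodule p Q hab K) := by
  rw [LK, graphSubmodule]
  congr 2
  ext1 f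
  simp [gammaPlus, gammaMinus]
  abel

theorem minSubmodule_le_graphSubmodule (hab : a < b)
    (K : EuclideanSpace ℂ (Fin 2) →L[ℂ] EuclideanSpace ℂ (Fin 2)) :
    minSubmodule p Q hab ≤ graphSubmodule p Q hab K := by
  intro f hf
  obtain ⟨h₁, h₂⟩ := (mem_minSubmodule hab).1 hf
  simp [mem_graphSubmodule, gammaPlus, gammaMinus, h₁, h₂]

/-- Every `x` occurs as `Γ₊ f` with `Γ₋ f = K x`, so the boundary condition recovers `K` pointwise.
-/
theorem graphSubmodule_injective (hr : IsRegular p Q a b) (hab : a < b) :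
    Function.Injective (graphSubmodule p Q hab) := by
  intro K K' h
  ext1 x
  obtain ⟨f, h₁, h₂⟩ := exists_gammaPlus_eq hr hab x (K x)
  have hf : f ∈ graphSubmodule p Q hab K := (mem_graphSubmodule hab).2 (by rw [h₁, h₂])
  rw [h, mem_graphSubmodule, h₁, h₂] at hf
  exact hf.symm

theorem dense_restrictMax_domain (hr : IsRegular p Q a b) (hab : a < b)
    {S : Submodule ℂ (maxDomain p Q a b)} (hS : minSubmodule p Q hab ≤ S) :
    Dense ((restrictMax p Q hab S).domain : Set (L2 a b)) := by
  rw [Submodule.dense_iff_topologicalClosure_eq_top, Submodule.topologicalClosure_eq_top_iff,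
    Submodule.eq_bot_iff]
  intro h hh
  rw [Submodule.mem_orthogonal'] at hh
  exact eq_zero_of_inner_eq_zero hr hab h fun f h₁ h₂ =>
    hh f ((mem_restrictMax_domain hab).2 ⟨f, hS ⟨h₁, h₂⟩, rfl⟩)

theorem im_inner_lmax (hr : IsRegular p Q a b) (hab : a < b) (f : maxDomain p Q a b) :
    4 * (inner ℂ (f : L2 a b) (lmax p Q hab f)).im =
      ‖gammaPlus p Q hab f‖ ^ 2 - ‖gammaMinus p Q hab f‖ ^ 2 := by
  have h := congrArg Complex.im (green hr hab f f)
  rw [← inner_conj_symm (lmax p Q hab f) (f : L2 a b),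
    ← inner_conj_symm (Gamma1 p Q hab f) (Gamma2 p Q hab f)] at h
  simp only [Complex.sub_im, Complex.conj_im] at h
  have h' := norm_add_I_smul_sq_sub (Gamma1 p Q hab f) (Gamma2 p Q hab f)
  simp only [gammaPlus, gammaMinus, LinearMap.add_apply, LinearMap.sub_apply,
    LinearMap.smul_apply]
  rw [h']
  linarith

theorem isDissipative_restrictMax_iff (hr : IsRegular p Q a b) (hab : a < b)
    {S : Submodule ℂ (maxDomain p Q a b)} (hS : minSubmodule p Q hab ≤ S) :
    IsDissipative (restrictMax p Q hab S) ↔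
      ∀ f ∈ S, ‖gammaMinus p Q hab f‖ ≤ ‖gammaPlus p Q hab f‖ := by
  have key : ∀ f : maxDomain p Q a b, 0 ≤ (inner ℂ (f : L2 a b) (lmax p Q hab f)).im ↔
      ‖gammaMinus p Q hab f‖ ≤ ‖gammaPlus p Q hab f‖ := fun f => by
    rw [← sq_le_sq₀ (norm_nonneg _) (norm_nonneg _),
      ← sub_nonneg (a := ‖gammaPlus p Q hab f‖ ^ 2), ← im_inner_lmax hr hab]
    exact (mul_nonneg_iff_of_pos_left four_pos).symm
  refine ⟨fun h f hf => ?_, fun h => ⟨dense_restrictMax_domain hr hab hS, fun f => ?_⟩⟩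
  · have h1 := h.2 ⟨f, (mem_restrictMax_domain hab).2 ⟨f, hf, rfl⟩⟩
    rw [restrictMax_apply hab _ f rfl] at h1
    exact (key f).1 h1
  · obtain ⟨g, hg, hgf⟩ := (mem_restrictMax_domain hab).1 f.2
    rw [restrictMax_apply hab f g hgf.symm, ← hgf]
    exact (key g).2 (h g hg)

theorem isSymmetricOp_Lmin (hr : IsRegular p Q a b) (hab : a < b) :
    IsSymmetricOp (Lmin p Q hab) := by
  rw [Lmin_eq]
  refine ⟨dense_restrictMax_domain hr hab le_rfl, fun f g => ?_⟩
  obtain ⟨u, hu, huf⟩ := (mem_restrictMax_domain hab).1 f.2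
  obtain ⟨v, -, hvg⟩ := (mem_restrictMax_domain hab).1 g.2
  rw [restrictMax_apply hab f u huf.symm, restrictMax_apply hab g v hvg.symm, ← huf, ← hvg]
  obtain ⟨h₁, h₂⟩ := (mem_minSubmodule hab).1 hu
  have h := green hr hab v u
  rw [h₁, h₂, inner_zero_left, inner_zero_left, sub_zero, sub_eq_zero] at h
  exact h.symm

/-- A dissipative extension of the minimal operator is a restriction of the maximal one. -/
theorem exists_eq_restrictMax (hr : IsRegular p Q a b) (hab : a < b)
    {B : L2 a b →ₗ.[ℂ] L2 a b} (hB : IsDissipative B) (hle : Lmin p Q hab ≤ B) :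
    ∃ S, minSubmodule p Q hab ≤ S ∧ B = restrictMax p Q hab S := by
  rw [Lmin_eq, restrictMax_le_iff] at hle
  have key : ∀ g : B.domain, ∃ g' : maxDomain p Q a b,
      (g' : L2 a b) = g ∧ lmax p Q hab g' = B g := by
    intro g
    refine exists_lmax_eq_of_adjoint hr hab g (B g) fun f h₁ h₂ => ?_
    obtain ⟨hf, hBf⟩ := hle f ⟨h₁, h₂⟩
    have h0 : (inner ℂ (f : L2 a b) (lmax p Q hab f)).im = 0 := by
      have h := im_inner_lmax hr hab f
      simp only [gammaPlus, gammaMinus, LinearMap.add_apply, LinearMap.sub_apply,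
        LinearMap.smul_apply, h₁, h₂, smul_zero, add_zero, sub_zero] at h
      simpa using h
    -- Dissipativity at `g + c f` with `f ∈ Dom(L_min)`: the `|c|²` term is real by symmetry, so the
    -- imaginary part is real-affine in `c`. Being bounded below, it has zero slope along `c = t`
    -- and `c = t i`, which gives the adjoint relation.
    have hc : ∀ c : ℂ, 0 ≤ (inner ℂ (g : L2 a b) (B g)).im +
        (c * inner ℂ (g : L2 a b) (lmax p Q hab f) +
          star c * inner ℂ (f : L2 a b) (B g)).im := by
      intro c
      have h := hB.2 (g + c • ⟨f, hf⟩)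
      rw [B.map_add, B.map_smul, hBf, Submodule.coe_add, Submodule.coe_smul, inner_add_left,
        inner_add_right, inner_add_right, inner_smul_left, inner_smul_left, inner_smul_right,
        inner_smul_right, ← mul_assoc, mul_comm (starRingEnd ℂ c) c, Complex.mul_conj] at h
      rw [Complex.add_im, Complex.add_im, Complex.add_im, Complex.im_ofReal_mul, h0, mul_zero,
        add_zero] at h
      rw [Complex.add_im, ← add_assoc]
      exact h
    have h₁ := eq_zero_of_forall_nonneg_add_mul
      (B := (inner ℂ (g : L2 a b) (lmax p Q hab f) + inner ℂ (f : L2 a b) (B g)).im) fun t => by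
        have h := hc t
        simp only [Complex.star_def, Complex.conj_ofReal, ← mul_add, Complex.im_ofReal_mul] at h
        exact h
    have h₂ := eq_zero_of_forall_nonneg_add_mul
      (B := (inner ℂ (g : L2 a b) (lmax p Q hab f) - inner ℂ (f : L2 a b) (B g)).re) fun t => by
        have h := hc (t * Complex.I)
        convert h using 2
        simp
        ring
    rw [Complex.add_im] at h₁
    rw [Complex.sub_re] at h₂
    rw [← inner_conj_symm (B g) (f : L2 a b)]
    apply Complex.ext
    · rw [Complex.conj_re]
      linarith
    · rw [Complex.conj_im]
      linarith
  have hle' : B ≤ restrictMax p Q hab (B.domain.comap (maxDomain p Q a b).subtype) := by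
    refine ⟨fun g hg => ?_, fun g u hgu => ?_⟩
    · obtain ⟨g', h, -⟩ := key ⟨g, hg⟩
      exact (mem_restrictMax_domain hab).2 ⟨g', by simpa [h] using hg, h⟩
    · obtain ⟨g', h, h'⟩ := key g
      rw [← h', restrictMax_apply hab u g' (hgu.symm.trans h.symm)]
  refine ⟨B.domain.comap (maxDomain p Q a b).subtype, fun f hf => (hle f hf).1,
    le_antisymm hle' ((restrictMax_le_iff hab).2 fun f hf => ?_)⟩
  obtain ⟨g', h, h'⟩ := key ⟨f, hf⟩
  have : g' = f := Subtype.ext h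
  exact ⟨hf, by rw [← h', this]⟩

theorem isMaximalDissipative_LK (hr : IsRegular p Q a b) (hab : a < b)
    {K : EuclideanSpace ℂ (Fin 2) →L[ℂ] EuclideanSpace ℂ (Fin 2)} (hK : ‖K‖ ≤ 1) :
    IsMaximalDissipative (LK p Q hab K) := by
  rw [LK_eq]
  have hmin := minSubmodule_le_graphSubmodule (p := p) (Q := Q) hab K
  refine ⟨(isDissipative_restrictMax_iff hr hab hmin).2 fun f hf => ?_, fun B hB hle => ?_⟩
  · rw [← (mem_graphSubmodule hab).1 hf]
    exact K.le_of_opNorm_le_of_le hK le_rfl |>.trans_eq (one_mul _)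
  · obtain ⟨S, hS, rfl⟩ := exists_eq_restrictMax hr hab hB
      ((Lmin_eq hab).trans_le (((restrictMax_le_restrictMax_iff hab).2 hmin).trans hle))
    rw [isDissipative_restrictMax_iff hr hab hS] at hB
    rw [restrictMax_le_restrictMax_iff] at hle
    congr 1
    refine le_antisymm (fun g hg => ?_) hle
    -- Compare `g` with some `f ∈ Dom(L_K)` having the same `Γ₊`: dissipativity at `g - f` forces
    -- `Γ₋ g = Γ₋ f = K Γ₊ g`.
    obtain ⟨f, h₁, h₂⟩ := exists_gammaPlus_eq hr hab (gammaPlus p Q hab g)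
      (K (gammaPlus p Q hab g))
    have hf : f ∈ S := hle ((mem_graphSubmodule hab).2 (by rw [h₁, h₂]))
    have h := hB _ (S.sub_mem hg hf)
    rw [map_sub, map_sub, h₁, h₂, sub_self, norm_zero, norm_le_zero_iff, sub_eq_zero] at h
    exact (mem_graphSubmodule hab).2 h.symm

theorem exists_eq_LK (hr : IsRegular p Q a b) (hab : a < b) {L : L2 a b →ₗ.[ℂ] L2 a b}
    (hle : Lmin p Q hab ≤ L) (hL : IsMaximalDissipative L) :
    ∃ K : EuclideanSpace ℂ (Fin 2) →L[ℂ] EuclideanSpace ℂ (Fin 2),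
      ‖K‖ ≤ 1 ∧ L = LK p Q hab K := by
  obtain ⟨S, hS, rfl⟩ := exists_eq_restrictMax hr hab hL.1 hle
  have hdis := (isDissipative_restrictMax_iff hr hab hS).1 hL.1
  obtain ⟨K, hK, hKS⟩ := exists_contraction (gammaPlus p Q hab ∘ₗ S.subtype)
    (gammaMinus p Q hab ∘ₗ S.subtype) fun f => hdis f f.2
  -- `L_K` is a dissipative extension of the given operator, so maximality forces equality.
  refine ⟨K, hK, (hL.2 _ (isMaximalDissipative_LK hr hab hK).1 ?_).symm⟩
  rw [LK_eq, restrictMax_le_restrictMax_iff]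
  exact fun f hf => (mem_graphSubmodule hab).2 (hKS ⟨f, hf⟩)

theorem LK_injective (hr : IsRegular p Q a b) (hab : a < b) :
    Function.Injective (LK p Q hab) := by
  intro K K' h
  rw [LK_eq, LK_eq] at h
  exact graphSubmodule_injective hr hab (restrictMax_injective hab h)

end restrict

end SturmLiouville

theorem mainTheorem3 (a b : ℝ) (hab : a < b) (p Q : ℝ → ℝ)
    (hp : ∀ᵐ t ∂volume.restrict (Ioo a b), p t ≠ 0)
    (hp1 : IntegrableOn (fun t => 1 / p t) (Ioo a b))
    (hQp : IntegrableOn (fun t => Q t / p t) (Ioo a b))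
    (hQ2p : IntegrableOn (fun t => Q t ^ 2 / p t) (Ioo a b)) :
    SturmLiouville.IsSymmetricOp (SturmLiouville.Lmin p Q hab) ∧
    (∀ K : EuclideanSpace ℂ (Fin 2) →L[ℂ] EuclideanSpace ℂ (Fin 2), ‖K‖ ≤ 1 →
      SturmLiouville.Lmin p Q hab ≤ SturmLiouville.LK p Q hab K ∧
      SturmLiouville.IsMaximalDissipative (SturmLiouville.LK p Q hab K)) ∧
    (∀ L : SturmLiouville.L2 a b →ₗ.[ℂ] SturmLiouville.L2 a b,
      SturmLiouville.Lmin p Q hab ≤ L → SturmLiouville.IsMaximalDissipative L →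
      ∃! K : EuclideanSpace ℂ (Fin 2) →L[ℂ] EuclideanSpace ℂ (Fin 2),
        ‖K‖ ≤ 1 ∧ L = SturmLiouville.LK p Q hab K) ∧
    Set.BijOn (SturmLiouville.LK p Q hab)
      {K : EuclideanSpace ℂ (Fin 2) →L[ℂ] EuclideanSpace ℂ (Fin 2) | ‖K‖ ≤ 1}
      {L : SturmLiouville.L2 a b →ₗ.[ℂ] SturmLiouville.L2 a b |
        SturmLiouville.Lmin p Q hab ≤ L ∧ SturmLiouville.IsMaximalDissipative L} := by
  have hr : SturmLiouville.IsRegular p Q a b := ⟨hp, hp1, hQp, hQ2p⟩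
  have h₁ : ∀ K : EuclideanSpace ℂ (Fin 2) →L[ℂ] EuclideanSpace ℂ (Fin 2), ‖K‖ ≤ 1 →
      SturmLiouville.Lmin p Q hab ≤ SturmLiouville.LK p Q hab K ∧
      SturmLiouville.IsMaximalDissipative (SturmLiouville.LK p Q hab K) := fun K hK => by
    refine ⟨?_, SturmLiouville.isMaximalDissipative_LK hr hab hK⟩
    rw [SturmLiouville.Lmin_eq, SturmLiouville.LK_eq,
      SturmLiouville.restrictMax_le_restrictMax_iff]
    exact SturmLiouville.minSubmodule_le_graphSubmodule hab K
  refine ⟨SturmLiouville.isSymmetricOp_Lmin hr hab, h₁, fun L hle hL => ?_, h₁,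
    (SturmLiouville.LK_injective hr hab).injOn, fun L hL => ?_⟩
  · obtain ⟨K, hK, rfl⟩ := SturmLiouville.exists_eq_LK hr hab hle hL
    exact ⟨K, ⟨hK, rfl⟩, fun K' hK' => (SturmLiouville.LK_injective hr hab hK'.2).symm⟩
  · obtain ⟨K, hK, rfl⟩ := SturmLiouville.exists_eq_LK hr hab hL.1 hL.2
    exact ⟨K, hK, rfl⟩
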